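/- Let $N\in\mathbb N$, let $a_1,\dots,a_N\in\mathbb C\setminus\{0\}$, and let $z_1,\dots,z_N$ be pairwise different complex numbers with $0<|z_j|<1$. Put $f_k=\sum_{j=1}^N a_jz_j^k$ for $k\in\mathbb N_0$ and let $\Gamma_f v=\big(\sum_{j\ge 0}f_{k+j}v_j\big)_{k\ge 0}$ be the (bounded) Hankel operator on $\ell^2=\ell^2(\mathbb N_0)$ generated by $f\in\ell^1$. Let $\sigma_0\ge\sigma_1\ge\cdots$ be the singular values of $\Gamma_f$, where $\sigma_n=\inf\{\|\Gamma_f-R\| : R \text{ bounded on } \ell^2,\ \operatorname{rank}R\le n\}$. Let $K\in\{0,\dots,N-1\}$ be such that $\sigma_K\ne\sigma_k$ for all $k\in\{0,\dots,N-1\}$ with $k\ne K$, and let $v\in\ell^2$, $v\ne 0$, be a con-eigenvector for $\sigma_K$, i.e. $\Gamma_f\overline v=\sigma_K v$, where the bar denotes entrywise complex conjugation. Then $P_v(z)=\sum_{k\ge 0}v_kz^k$ has only finitely many zeros $\alpha_1,\dots,\alpha_{n_K}$ (listed with multiplicity) in the open unit disc $\{|z|<1\}$. Let $$B(e^{i\omega})=\prod_{j=1}^{n_K}\frac{e^{i\omega}-\alpha_j}{1-\overline{\alpha_j}\,e^{i\omega}}$$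 (with $B=1$ if $n_K=0$) be their Blaschke product and $b_k=\frac1{2\pi}\int_0^{2\pi}B(e^{i\omega})e^{-ik\omega}\,d\omega$, $k\ge0$, its Fourier coefficients. Then $b=(b_k)_{k\ge0}\in\ell^1$, and, with $T_g$ denoting for $g\in\ell^1$ the lower triangular Toeplitz operator $T_gv=\big(\sum_{j=0}^k g_{k-j}v_j\big)_{k\ge0}$ on $\ell^2$, the operator $A=\Gamma_fT_{\overline b}$ has the singular value $\sigma_K$ with multiplicity at least $n_K+1$, i.e. the eigenspace of $A^*A$ for the eigenvalue $\sigma_K^2$ has dimension at least $n_K+1$. In particular, $n_K\le K$. -/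

import Mathlib

open scoped ENNReal ComplexConjugate

noncomputable section

namespace ExpSumHankel

/-- The space `ℓᵖ(ℕ₀)` of complex sequences. -/
abbrev Ell (p : ℝ≥0∞) : Type := lp (fun _ : ℕ => ℂ) p

theorem Ell.summable_norm (f : Ell 1) : Summable fun k => ‖f k‖ := by
  simpa using (lp.memℓp f).summable (by simp)

theorem Ell.norm_eq_tsum_norm (f : Ell 1) : ‖f‖ = ∑' k, ‖f k‖ := by
  simpa using lp.norm_eq_tsum_rpow (p := 1) (by simp) f

/-- If the absolute row and column sums of an infinite matrix are at most `C`, the matrix acts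
on square summable sequences, with norm at most `C`. -/
theorem schur_bound {M : ℕ → ℕ → ℂ} {C : ℝ} (hC : 0 ≤ C)
    (hr : ∀ i (t : Finset ℕ), ∑ j ∈ t, ‖M i j‖ ≤ C)
    (hc : ∀ j (s : Finset ℕ), ∑ i ∈ s, ‖M i j‖ ≤ C) (v : Ell 2) :
    (∀ i, Summable fun j => M i j * v j) ∧
      ∀ s : Finset ℕ, ∑ i ∈ s, ‖∑' j, M i j * v j‖ ^ 2 ≤ (C * ‖v‖) ^ 2 := by
  have hv2 : HasSum (fun j => ‖v j‖ ^ 2) (‖v‖ ^ 2) := by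
    simpa using lp.hasSum_norm (p := 2) (by simp) v
  have hvb : ∀ j, ‖v j‖ ≤ ‖v‖ := fun j => lp.norm_apply_le_norm (by simp) v j
  have hMs : ∀ i, Summable fun j => ‖M i j‖ := fun i =>
    summable_of_sum_le (fun _ => norm_nonneg _) (hr i)
  have hMc : ∀ i j, ‖M i j‖ ≤ C := fun i j => by simpa using hr i {j}
  have hs1 : ∀ i, Summable fun j => ‖M i j * v j‖ := fun i => by
    refine Summable.of_nonneg_of_le (fun _ => norm_nonneg _) (fun j => ?_)
      ((hMs i).mul_right ‖v‖)
    rw [norm_mul]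
    exact mul_le_mul_of_nonneg_left (hvb j) (norm_nonneg _)
  have hs2 : ∀ i, Summable fun j => ‖M i j‖ * ‖v j‖ ^ 2 := fun i =>
    Summable.of_nonneg_of_le (fun _ => by positivity)
      (fun j => mul_le_mul_of_nonneg_right (hMc i j) (by positivity)) (hv2.summable.mul_left C)
  refine ⟨fun i => (hs1 i).of_norm, fun s => ?_⟩
  have hrow : ∀ i, ‖∑' j, M i j * v j‖ ^ 2 ≤ C * ∑' j, ‖M i j‖ * ‖v j‖ ^ 2 := by
    intro i
    have hnn : 0 ≤ ∑' j, ‖M i j‖ * ‖v j‖ ^ 2 := tsum_nonneg fun _ => by positivity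
    have h1 : ‖∑' j, M i j * v j‖ ≤ √(C * ∑' j, ‖M i j‖ * ‖v j‖ ^ 2) := by
      refine (norm_tsum_le_tsum_norm (hs1 i)).trans ?_
      refine Real.tsum_le_of_sum_le (fun _ => norm_nonneg _) fun t => ?_
      refine Real.le_sqrt_of_sq_le ?_
      have h2 := Finset.sum_sq_le_sum_mul_sum_of_sq_le_mul t
        (r := fun j => ‖M i j * v j‖) (f := fun j => ‖M i j‖)
        (g := fun j => ‖M i j‖ * ‖v j‖ ^ 2)
        (fun _ _ => norm_nonneg _) (fun _ _ => by positivity)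
        (fun j _ => by simp only [norm_mul]; exact le_of_eq (by ring))
      refine h2.trans (mul_le_mul (hr i t) ?_ (Finset.sum_nonneg fun _ _ => by positivity) hC)
      exact (hs2 i).sum_le_tsum t fun _ _ => by positivity
    have := pow_le_pow_left₀ (norm_nonneg _) h1 2
    rwa [Real.sq_sqrt (mul_nonneg hC hnn)] at this
  calc ∑ i ∈ s, ‖∑' j, M i j * v j‖ ^ 2
      ≤ ∑ i ∈ s, C * ∑' j, ‖M i j‖ * ‖v j‖ ^ 2 := Finset.sum_le_sum fun i _ => hrow i
    _ = C * ∑' j, ∑ i ∈ s, ‖M i j‖ * ‖v j‖ ^ 2 := by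
        rw [← Finset.mul_sum, Summable.tsum_finsetSum fun i _ => hs2 i]
    _ ≤ C * ∑' j, C * ‖v j‖ ^ 2 := by
        refine mul_le_mul_of_nonneg_left ?_ hC
        refine Summable.tsum_le_tsum (fun j => ?_) (summable_sum fun i _ => hs2 i)
          (hv2.summable.mul_left C)
        rw [← Finset.sum_mul]
        exact mul_le_mul_of_nonneg_right (hc j s) (by positivity)
    _ = (C * ‖v‖) ^ 2 := by rw [tsum_mul_left, hv2.tsum_eq]; ring

/-- The bounded operator `v ↦ (∑ⱼ M i j * v j)ᵢ` on `ℓ²` of an infinite matrix whose absolute row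
and column sums are bounded by `C`. -/
def matrixOp (M : ℕ → ℕ → ℂ) (C : ℝ) (hC : 0 ≤ C)
    (hr : ∀ i (t : Finset ℕ), ∑ j ∈ t, ‖M i j‖ ≤ C)
    (hc : ∀ j (s : Finset ℕ), ∑ i ∈ s, ‖M i j‖ ≤ C) : Ell 2 →L[ℂ] Ell 2 :=
  LinearMap.mkContinuous
    { toFun := fun v => ⟨fun i => ∑' j, M i j * v j, memℓp_gen' (C := (C * ‖v‖) ^ 2) fun s => by
        simpa using (schur_bound hC hr hc v).2 s⟩
      map_add' := fun v w => by
        ext i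
        have h1 := (schur_bound hC hr hc v).1 i
        have h2 := (schur_bound hC hr hc w).1 i
        simp only [lp.coeFn_add, Pi.add_apply, mul_add]
        exact h1.tsum_add h2
      map_smul' := fun c v => by
        ext i
        simp only [lp.coeFn_smul, Pi.smul_apply, smul_eq_mul, RingHom.id_apply, ← tsum_mul_left]
        exact tsum_congr fun j => by ring }
    C fun v => lp.norm_le_of_forall_sum_le (by simp) (by positivity) fun s => by
      simpa using (schur_bound hC hr hc v).2 s

theorem matrixOp_apply (M : ℕ → ℕ → ℂ) (C : ℝ) (hC : 0 ≤ C)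
    (hr : ∀ i (t : Finset ℕ), ∑ j ∈ t, ‖M i j‖ ≤ C)
    (hc : ∀ j (s : Finset ℕ), ∑ i ∈ s, ‖M i j‖ ≤ C) (v : Ell 2) (i : ℕ) :
    matrixOp M C hC hr hc v i = ∑' j, M i j * v j := rfl

theorem hankel_row (f : Ell 1) (i : ℕ) (t : Finset ℕ) : ∑ j ∈ t, ‖f (i + j)‖ ≤ ‖f‖ := by
  rw [Ell.norm_eq_tsum_norm]
  have h := f.summable_norm.sum_le_tsum (t.map (addLeftEmbedding i)) fun _ _ => norm_nonneg _
  rwa [Finset.sum_map] at h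

theorem toeplitz_row (g : Ell 1) (i : ℕ) (t : Finset ℕ) :
    ∑ j ∈ t, ‖if j ≤ i then g (i - j) else 0‖ ≤ ‖g‖ := by
  rw [Ell.norm_eq_tsum_norm]
  simp only [apply_ite norm, norm_zero]
  rw [← Finset.sum_filter, ← Finset.sum_image (s := t.filter (· ≤ i)) (g := fun j => i - j)
    (f := fun k => ‖g k‖)]
  · exact g.summable_norm.sum_le_tsum _ fun _ _ => norm_nonneg _
  · intro a ha b hb hab
    simp only [Finset.coe_filter, Set.mem_ofPred_eq] at ha hb hab
    omega

theorem toeplitz_col (g : Ell 1) (j : ℕ) (s : Finset ℕ) :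
    ∑ i ∈ s, ‖if j ≤ i then g (i - j) else 0‖ ≤ ‖g‖ := by
  rw [Ell.norm_eq_tsum_norm]
  simp only [apply_ite norm, norm_zero]
  rw [← Finset.sum_filter, ← Finset.sum_image (s := s.filter (j ≤ ·)) (g := fun i => i - j)
    (f := fun k => ‖g k‖)]
  · exact g.summable_norm.sum_le_tsum _ fun _ _ => norm_nonneg _
  · intro a ha b hb hab
    simp only [Finset.coe_filter, Set.mem_ofPred_eq] at ha hb hab
    omega

/-- The Hankel operator `Γ_f v = (∑ⱼ f_{i+j} v_j)ᵢ` on `ℓ²`, for `f ∈ ℓ¹`. -/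
def hankelOp (f : Ell 1) : Ell 2 →L[ℂ] Ell 2 :=
  matrixOp (fun i j => f (i + j)) ‖f‖ (norm_nonneg f) (hankel_row f)
    fun j s => by simpa only [add_comm] using hankel_row f j s

/-- The lower triangular Toeplitz operator `T_g v = (∑_{j ≤ i} g_{i-j} v_j)ᵢ` on `ℓ²`,
for `g ∈ ℓ¹`. -/
def toeplitzOp (g : Ell 1) : Ell 2 →L[ℂ] Ell 2 :=
  matrixOp (fun i j => if j ≤ i then g (i - j) else 0) ‖g‖ (norm_nonneg g) (toeplitz_row g)
    (toeplitz_col g)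

theorem hankelOp_apply (f : Ell 1) (v : Ell 2) (i : ℕ) :
    hankelOp f v i = ∑' j, f (i + j) * v j := rfl

theorem toeplitzOp_apply (g : Ell 1) (v : Ell 2) (i : ℕ) :
    toeplitzOp g v i = ∑ j ∈ Finset.range (i + 1), g (i - j) * v j := by
  have h : toeplitzOp g v i = ∑' j, (if j ≤ i then g (i - j) else 0) * v j := rfl
  rw [h, tsum_eq_sum (s := Finset.range (i + 1))]
  · refine Finset.sum_congr rfl fun j hj => ?_
    rw [if_pos (by simpa [Nat.lt_succ_iff] using hj)]
  · intro j hj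
    rw [if_neg (by simpa [Nat.lt_succ_iff] using hj), zero_mul]

theorem memℓp_expSum {N : ℕ} (a z : Fin N → ℂ) (hz : ∀ j, ‖z j‖ < 1) :
    Memℓp (fun k : ℕ => ∑ j, a j * z j ^ k) 1 := by
  refine memℓp_gen ?_
  simp only [ENNReal.toReal_one, Real.rpow_one]
  refine Summable.norm (summable_sum fun j _ => ?_)
  exact (summable_geometric_of_norm_lt_one (hz j)).mul_left _

/-- The exponential sum `f_k = ∑ⱼ a_j z_j ^ k`, as an element of `ℓ¹`. -/
def expSum {N : ℕ} (a z : Fin N → ℂ) (hz : ∀ j, ‖z j‖ < 1) : Ell 1 :=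
  ⟨fun k => ∑ j, a j * z j ^ k, memℓp_expSum a z hz⟩

/-- The `n`-th singular value (counted from `0`, in decreasing order, with multiplicity):
the distance in operator norm from `A` to the operators of rank at most `n`. -/
def singularValue (A : Ell 2 →L[ℂ] Ell 2) (n : ℕ) : ℝ :=
  sInf {r : ℝ | ∃ R : Ell 2 →L[ℂ] Ell 2, LinearMap.rank (R : Ell 2 →ₗ[ℂ] Ell 2) ≤ n ∧
    r = ‖A - R‖}

/-- The multiplicity of `s` as a singular value of `A`: the dimension of the eigenspace of `A* A`
for the eigenvalue `s²`. -/
def singularMultiplicity (A : Ell 2 →L[ℂ] Ell 2) (s : ℝ) : Cardinal :=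
  Module.rank ℂ (Module.End.eigenspace
    ((ContinuousLinearMap.adjoint A ∘L A : Ell 2 →L[ℂ] Ell 2) : Module.End ℂ (Ell 2))
    ((s ^ 2 : ℝ) : ℂ))

/-- `P_v(z) = ∑ₖ v_k z ^ k`, used for `|z| < 1`. -/
def genFun (v : Ell 2) (z : ℂ) : ℂ := ∑' k, v k * z ^ k

/-- `s` is the multiset of all zeros of `P_v` in the open unit disc, each repeated according to
its multiplicity. -/
def IsZerosInDisc (v : Ell 2) (s : Multiset ℂ) : Prop :=
  (∀ α : ℂ, ‖α‖ < 1 → analyticOrderAt (genFun v) α = (s.count α : ℕ∞)) ∧ ∀ α ∈ s, ‖α‖ < 1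

/-- The Blaschke product `B(w) = ∏ (w - α) / (1 - conj α * w)` over a finite multiset of zeros. -/
def blaschke (s : Multiset ℂ) (w : ℂ) : ℂ :=
  (s.map fun α => (w - α) / (1 - conj α * w)).prod

/-- The Fourier coefficients `b_k = (2π)⁻¹ ∫_0^{2π} B(e^{iω}) e^{-ikω} dω` of the Blaschke
product. -/
def blaschkeCoeff (s : Multiset ℂ) (k : ℕ) : ℂ :=
  (2 * Real.pi : ℂ)⁻¹ * ∫ ω in (0 : ℝ)..2 * Real.pi,
    blaschke s (Complex.exp (Complex.I * ω)) * Complex.exp (-(Complex.I * k * ω))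

end ExpSumHankel

end

open ExpSumHankel

/-! ### Absolutely summable power series acting on `ℓ²` -/

namespace ExpSumHankel

open PowerSeries (coeff)

/-! Write `T_p` for multiplication by an absolutely summable power series `p`, and `Γ` for the
Hankel operator. Geometric sequences are eigenvectors of every `T_p*`, and `Γ` is a sum of rank-one
operators onto them; hence `Γ T_{p̄} = T_p* Γ` (`hankelOp_toeplitzOp_star`).

Since `σ_K > 0`, the con-eigenvector `v` lies in the range of `Γ`, so `P_v = q / D` with polynomials
`q` and `D = ∏ (1 - z_j X)`. As `D` has no zeros in the disc, the zeros of `P_v` there are those of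
`q`. Dividing them out gives `v = ∏ (X - α) w` with `w ∈ ℓ²`.

Let `n` be the number of zeros and `A = Γ T_{b̄}`. The commutation rule and the identity `∏ (X - α)
w = T_r* (Xⁿ w)`, `r = ∏ (1 - ᾱ X)`, show that `A` sends the conjugate of `Xⁱ w` to `σ_K Xⁿ⁻ⁱ w`
(`hankelOp_blaschke_apply`). Because `A* x̄` is the conjugate of `A x`, the conjugates of `w, X w,
…, Xⁿ w` are `n + 1` independent eigenvectors of `A* A` for `σ_K²` (`le_singularMultiplicity`).

Finally `‖T_{b̄}‖ ≤ 1` gives `σ_K ≤ σ_n(A) ≤ σ_n(Γ)`, which for `n > K` contradicts the simplicity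
or the positivity of `σ_K` (`card_le_of_simple`). -/

/-- The algebra of formal power series with absolutely summable coefficients. -/
def wiener : Subalgebra ℂ (PowerSeries ℂ) where
  carrier := {p | Summable fun k => ‖coeff k p‖}
  mul_mem' {p q} hp hq := by
    simpa [PowerSeries.coeff_mul] using
      summable_norm_sum_mul_antidiagonal_of_summable_norm hp hq
  add_mem' {p q} hp hq := by
    refine Summable.of_nonneg_of_le (fun _ => norm_nonneg _) (fun k => ?_) (hp.add hq)
    simpa using norm_add_le (coeff k p) (coeff k q)
  algebraMap_mem' c := by
    refine summable_of_ne_finset_zero (s := {0}) fun k hk => ?_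
    simp only [Finset.mem_singleton] at hk
    simp [PowerSeries.coeff_C, hk]

theorem mem_wiener {p : PowerSeries ℂ} : p ∈ wiener ↔ Summable fun k => ‖coeff k p‖ := Iff.rfl

/-- The coefficient sequence of an absolutely summable power series. -/
noncomputable def wienerCoeff (p : wiener) : Ell 1 :=
  ⟨fun k => coeff k (p : PowerSeries ℂ), memℓp_gen (by simpa using mem_wiener.1 p.2)⟩

theorem wienerCoeff_apply (p : wiener) (k : ℕ) :
    wienerCoeff p k = coeff k (p : PowerSeries ℂ) := rfl

/-- The power series with a given square summable coefficient sequence. -/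
noncomputable def series (v : Ell 2) : PowerSeries ℂ := PowerSeries.mk v

theorem coeff_series (v : Ell 2) (k : ℕ) : coeff k (series v) = v k := by simp [series]

theorem series_injective : Function.Injective series := fun v w h => by
  ext k
  rw [← coeff_series, h, coeff_series]

/-- This moves operator identities into the commutative ring of formal power series, where
multiplicativity of the action is associativity. -/
theorem series_toeplitzOp (p : wiener) (v : Ell 2) :
    series (toeplitzOp (wienerCoeff p) v) = p * series v := by
  ext k
  rw [coeff_series, toeplitzOp_apply, mul_comm, PowerSeries.coeff_mul,
    Finset.Nat.sum_antidiagonal_eq_sum_range_succ_mk]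
  exact Finset.sum_congr rfl fun j _ => by rw [wienerCoeff_apply, coeff_series, mul_comm]

/-- Multiplication by an absolutely summable power series on square summable sequences. -/
noncomputable def wienerOp : wiener →ₐ[ℂ] (Ell 2 →L[ℂ] Ell 2) :=
  AlgHom.ofLinearMap
    { toFun := fun p => toeplitzOp (wienerCoeff p)
      map_add' := fun p q => by
        ext v k
        simp [toeplitzOp_apply, wienerCoeff_apply, add_mul, Finset.sum_add_distrib]
      map_smul' := fun c p => by
        ext v k
        simp [toeplitzOp_apply, wienerCoeff_apply, Finset.mul_sum, mul_assoc] }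
    (by
      ext1 v
      apply series_injective
      simp [series_toeplitzOp])
    (fun p q => by
      ext1 v
      apply series_injective
      simp [series_toeplitzOp, mul_assoc])

theorem wienerOp_eq (p : wiener) : wienerOp p = toeplitzOp (wienerCoeff p) := rfl

theorem series_wienerOp (p : wiener) (v : Ell 2) :
    series (wienerOp p v) = p * series v := series_toeplitzOp p v

theorem tsum_coeff_mul {p q : PowerSeries ℂ} {w : ℂ}
    (hp : Summable fun k => ‖coeff k p * w ^ k‖) (hq : Summable fun k => ‖coeff k q * w ^ k‖) :
    ∑' k, coeff k (p * q) * w ^ k =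
      (∑' k, coeff k p * w ^ k) * ∑' k, coeff k q * w ^ k := by
  rw [tsum_mul_tsum_eq_tsum_sum_antidiagonal_of_summable_norm hp hq]
  refine tsum_congr fun k => ?_
  rw [PowerSeries.coeff_mul, Finset.sum_mul]
  refine Finset.sum_congr rfl fun x hx => ?_
  rw [← Finset.HasAntidiagonal.mem_antidiagonal.1 hx, pow_add]
  ring

theorem summable_wiener_eval (p : wiener) {w : ℂ} (hw : ‖w‖ ≤ 1) :
    Summable fun k => ‖coeff k (p : PowerSeries ℂ) * w ^ k‖ := by
  refine Summable.of_nonneg_of_le (fun _ => norm_nonneg _) (fun k => ?_) p.2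
  rw [norm_mul, norm_pow]
  exact mul_le_of_le_one_right (norm_nonneg _) (pow_le_one₀ (norm_nonneg _) hw)

theorem summable_ell_eval (v : Ell 2) {w : ℂ} (hw : ‖w‖ < 1) :
    Summable fun k => ‖v k * w ^ k‖ := by
  refine Summable.of_nonneg_of_le (fun _ => norm_nonneg _) (fun k => ?_)
    ((summable_geometric_of_lt_one (norm_nonneg w) hw).mul_left ‖v‖)
  rw [norm_mul, norm_pow]
  gcongr
  exact lp.norm_apply_le_norm (by simp) v k

/-- Evaluation of an absolutely summable power series at a point of the closed unit disc. -/
noncomputable def wienerEval (w : ℂ) (hw : ‖w‖ ≤ 1) : wiener →ₐ[ℂ] ℂ :=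
  AlgHom.ofLinearMap
    { toFun := fun p => ∑' k, coeff k (p : PowerSeries ℂ) * w ^ k
      map_add' := fun p q => by
        rw [← (summable_wiener_eval p hw).of_norm.tsum_add (summable_wiener_eval q hw).of_norm]
        exact tsum_congr fun k => by simp [add_mul]
      map_smul' := fun c p => by
        rw [RingHom.id_apply, smul_eq_mul, ← tsum_mul_left]
        exact tsum_congr fun k => by simp [mul_assoc] }
    (by
      change ∑' k, coeff k ((1 : wiener) : PowerSeries ℂ) * w ^ k = 1
      rw [tsum_eq_single 0 fun k hk => by simp [PowerSeries.coeff_one, hk]]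
      simp)
    (fun p q => tsum_coeff_mul (summable_wiener_eval p hw) (summable_wiener_eval q hw))

theorem wienerEval_apply (w : ℂ) (hw : ‖w‖ ≤ 1) (p : wiener) :
    wienerEval w hw p = ∑' k, coeff k (p : PowerSeries ℂ) * w ^ k := rfl

theorem genFun_wienerOp (p : wiener) (v : Ell 2) {w : ℂ} (hw : ‖w‖ < 1) :
    genFun (wienerOp p v) w = wienerEval w hw.le p * genFun v w := by
  have h := tsum_coeff_mul (q := series v) (summable_wiener_eval p hw.le)
    (by simpa only [coeff_series] using summable_ell_eval v hw)
  rw [← series_wienerOp] at h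
  simpa only [coeff_series, wienerEval_apply, genFun] using h

/-- The variable, as an absolutely summable power series. -/
noncomputable def wienerX : wiener :=
  ⟨PowerSeries.X, summable_of_ne_finset_zero (s := {1}) fun k hk => by
    simp only [Finset.mem_singleton] at hk
    simp [PowerSeries.coeff_X, hk]⟩

theorem wienerEval_X (w : ℂ) (hw : ‖w‖ ≤ 1) : wienerEval w hw wienerX = w := by
  rw [wienerEval_apply, tsum_eq_single 1 fun k hk => by simp [wienerX, PowerSeries.coeff_X, hk]]
  simp [wienerX]

/-- The geometric series `∑ zᵏ Xᵏ`. -/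
noncomputable def wienerGeom (z : ℂ) (hz : ‖z‖ < 1) : wiener :=
  ⟨PowerSeries.mk fun k => z ^ k, by
    simpa [mem_wiener] using summable_geometric_of_lt_one (norm_nonneg z) hz⟩

theorem wienerGeom_mul (z : ℂ) (hz : ‖z‖ < 1) :
    wienerGeom z hz * (1 - z • wienerX) = 1 := by
  apply Subtype.ext
  ext k
  rw [mul_sub, mul_one, mul_smul_comm]
  cases k <;> simp [wienerGeom, wienerX, PowerSeries.coeff_one, PowerSeries.coeff_succ_mul_X,
    pow_succ']

/-- A polynomial, as an absolutely summable power series. -/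
noncomputable def wienerPoly : Polynomial ℂ →ₐ[ℂ] wiener := Polynomial.aeval wienerX

theorem wienerEval_poly (w : ℂ) (hw : ‖w‖ ≤ 1) (p : Polynomial ℂ) :
    wienerEval w hw (wienerPoly p) = p.eval w := by
  rw [wienerPoly, ← Polynomial.aeval_algHom_apply, wienerEval_X, Polynomial.coe_aeval_eq_eval]

theorem wienerPoly_X : wienerPoly Polynomial.X = wienerX := Polynomial.aeval_X _

theorem coe_wienerPoly (p : Polynomial ℂ) : (wienerPoly p : PowerSeries ℂ) = p := by
  have h := Polynomial.aeval_algHom_apply wiener.val wienerX p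
  rw [wienerPoly, ← Subalgebra.val_apply, ← h, ← Polynomial.eval₂_C_X_eq_coe]
  rfl

theorem wienerPoly_injective : Function.Injective wienerPoly := fun p q h => by
  rw [← Polynomial.coe_inj, ← coe_wienerPoly, h, coe_wienerPoly]

/-- Formal power series over a field have no zero divisors. -/
theorem wienerOp_apply_eq_zero {p : wiener} {v : Ell 2} (h : wienerOp p v = 0) (hv : v ≠ 0) :
    p = 0 := by
  have h0 : series 0 = 0 := by ext k; simp [coeff_series]
  have h1 : (p : PowerSeries ℂ) * series v = 0 := by rw [← series_wienerOp, h, h0]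
  rcases mul_eq_zero.1 h1 with h2 | h2
  · exact Subtype.ext h2
  · exact absurd (series_injective (h2.trans h0.symm)) hv

/-- The sequence `(1, 0, 0, …)`. -/
noncomputable def unitVec : Ell 2 := lp.single 2 0 1

theorem series_unitVec : series unitVec = 1 := by
  ext k
  rw [coeff_series, PowerSeries.coeff_one, unitVec]
  by_cases h : k = 0
  · subst h; simp
  · simp [lp.single_apply, h]

theorem series_wienerOp_unitVec (p : wiener) : series (wienerOp p unitVec) = p := by
  rw [series_wienerOp, series_unitVec, mul_one]

theorem genFun_unitVec (w : ℂ) : genFun unitVec w = 1 := by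
  rw [genFun, tsum_eq_single 0 fun k hk => by simp [unitVec, lp.single_apply, hk]]
  simp [unitVec]

end ExpSumHankel

/-! ### Geometric vectors and the Hankel operator -/

namespace ExpSumHankel

open PowerSeries (coeff)
open ContinuousLinearMap (adjoint)
open scoped InnerProduct InnerProductSpace

/-- The geometric sequence `(zᵏ)`, as an element of `ℓ²`. -/
noncomputable def geomVec (z : ℂ) (hz : ‖z‖ < 1) : Ell 2 := wienerOp (wienerGeom z hz) unitVec

theorem wienerOp_geomVec (z : ℂ) (hz : ‖z‖ < 1) :
    wienerOp (1 - z • wienerX) (geomVec z hz) = unitVec := by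
  rw [geomVec, ← ContinuousLinearMap.comp_apply, ← ContinuousLinearMap.mul_def, ← map_mul,
    mul_comm, wienerGeom_mul, map_one]
  rfl

theorem geomVec_apply (z : ℂ) (hz : ‖z‖ < 1) (k : ℕ) : geomVec z hz k = z ^ k := by
  rw [← coeff_series, geomVec, series_wienerOp_unitVec]
  simp [wienerGeom]

theorem inner_star_star (x y : Ell 2) : ⟪star x, star y⟫_ℂ = ⟪y, x⟫_ℂ := by
  rw [lp.inner_eq_tsum, lp.inner_eq_tsum]
  exact tsum_congr fun k => by simp [lp.star_apply, mul_comm]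

theorem inner_geomVec (z : ℂ) (hz : ‖z‖ < 1) (x : Ell 2) :
    ⟪geomVec z hz, x⟫_ℂ = genFun x (conj z) := by
  rw [lp.inner_eq_tsum, genFun]
  exact tsum_congr fun k => by simp [geomVec_apply]

theorem genFun_star (x : Ell 2) (z : ℂ) : genFun (star x) (conj z) = conj (genFun x z) := by
  rw [genFun, genFun, Complex.conj_tsum]
  exact tsum_congr fun k => by simp [lp.star_apply]

theorem toeplitzOp_star (g : Ell 1) (x : Ell 2) :
    toeplitzOp (star g) (star x) = star (toeplitzOp g x) := by
  ext k
  simp [lp.star_apply, toeplitzOp_apply]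

theorem adjoint_star (A B : Ell 2 →L[ℂ] Ell 2) (h : ∀ x, A (star x) = star (B x)) (y : Ell 2) :
    adjoint A (star y) = star (adjoint B y) := by
  refine ext_inner_right ℂ fun x => ?_
  rw [ContinuousLinearMap.adjoint_inner_left, ← star_star x, h, inner_star_star, inner_star_star,
    ContinuousLinearMap.adjoint_inner_right]

/-- Pairing with a geometric vector evaluates the generating function at `conj z`, and evaluation is
multiplicative. -/
theorem adjoint_wienerOp_geomVec (p : wiener) (z : ℂ) (hz : ‖z‖ < 1) :
    adjoint (wienerOp p) (geomVec z hz) =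
      conj (wienerEval (conj z) (by simpa using hz.le) p) • geomVec z hz := by
  refine ext_inner_right ℂ fun x => ?_
  rw [ContinuousLinearMap.adjoint_inner_left, inner_smul_left, inner_geomVec, inner_geomVec,
    genFun_wienerOp _ _ (by simpa using hz), Complex.conj_conj]

section Hankel

variable {N : ℕ} (a z : Fin N → ℂ) (hz1 : ∀ j, ‖z j‖ < 1)

theorem hankelOp_expSum (x : Ell 2) :
    hankelOp (expSum a z hz1) x = ∑ j, (a j * genFun x (z j)) • geomVec (z j) (hz1 j) := by
  ext k
  rw [hankelOp_apply, lp.coeFn_sum, Finset.sum_apply]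
  simp only [lp.coeFn_smul, Pi.smul_apply, geomVec_apply, smul_eq_mul, genFun]
  have h : ∀ i, expSum a z hz1 (k + i) * x i = ∑ j, a j * z j ^ k * (x i * z j ^ i) := by
    intro i
    rw [show expSum a z hz1 (k + i) = ∑ j, a j * z j ^ (k + i) from rfl, Finset.sum_mul]
    exact Finset.sum_congr rfl fun j _ => by ring
  rw [tsum_congr h, Summable.tsum_finsetSum fun j _ =>
    (summable_ell_eval x (hz1 j)).of_norm.mul_left _]
  exact Finset.sum_congr rfl fun j _ => by rw [tsum_mul_left]; ring

/-- A Hankel matrix is symmetric, so its adjoint is its entrywise conjugate. -/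
theorem adjoint_hankelOp (x : Ell 2) :
    adjoint (hankelOp (expSum a z hz1)) (star x) = star (hankelOp (expSum a z hz1) x) := by
  refine ext_inner_right ℂ fun y => ?_
  rw [ContinuousLinearMap.adjoint_inner_left, ← star_star y, inner_star_star, star_star,
    hankelOp_expSum, hankelOp_expSum, inner_sum, inner_sum]
  have h : ∀ (u : Ell 2) j, ⟪star u, geomVec (z j) (hz1 j)⟫_ℂ = genFun u (z j) := fun u j => by
    rw [← inner_conj_symm, inner_geomVec, genFun_star, Complex.conj_conj]
  refine Finset.sum_congr rfl fun j _ => ?_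
  rw [inner_smul_right, inner_smul_right, h, h]
  ring

/-- In the expansion along geometric vectors, both sides multiply the `j`-th term by the same
number, the value at `z j` of the series with conjugated coefficients. -/
theorem hankelOp_toeplitzOp_star (p : wiener) (x : Ell 2) :
    hankelOp (expSum a z hz1) (toeplitzOp (star (wienerCoeff p)) x) =
      adjoint (wienerOp p) (hankelOp (expSum a z hz1) x) := by
  rw [hankelOp_expSum, hankelOp_expSum, map_sum]
  refine Finset.sum_congr rfl fun j _ => ?_
  rw [map_smul, adjoint_wienerOp_geomVec, smul_smul]
  congr 1
  have h : genFun (toeplitzOp (star (wienerCoeff p)) x) (z j) =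
      conj (genFun (wienerOp p (star x)) (conj (z j))) := by
    rw [← genFun_star, Complex.conj_conj, wienerOp_eq, ← toeplitzOp_star, star_star]
  rw [h, genFun_wienerOp _ _ (by simpa using hz1 j), map_mul, ← genFun_star, star_star,
    Complex.conj_conj]
  ring

theorem hankelOp_star_wienerOp (p : wiener) (x : Ell 2) :
    hankelOp (expSum a z hz1) (star (wienerOp p x)) =
      adjoint (wienerOp p) (hankelOp (expSum a z hz1) (star x)) := by
  rw [wienerOp_eq, ← toeplitzOp_star, hankelOp_toeplitzOp_star, wienerOp_eq]

end Hankel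

/-! ### Blaschke products as isometries -/

theorem norm_wienerOp_X (x : Ell 2) : ‖wienerOp wienerX x‖ = ‖x‖ := by
  have h1 := lp.hasSum_norm (p := 2) (by simp) (wienerOp wienerX x)
  have h2 := lp.hasSum_norm (p := 2) (by simp) x
  have h0 : wienerOp wienerX x 0 = 0 := by
    rw [← coeff_series, series_wienerOp]; simp [wienerX]
  have hs : ∀ k, wienerOp wienerX x (k + 1) = x k := fun k => by
    rw [← coeff_series, series_wienerOp]; simp [wienerX, coeff_series]
  rw [← hasSum_nat_add_iff' 1] at h1
  simp only [Finset.sum_range_one, h0, hs] at h1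
  have h3 := h1.unique h2
  simp at h3
  exact h3

theorem adjoint_wienerOp_X_comp : adjoint (wienerOp wienerX) ∘L wienerOp wienerX = 1 :=
  (ContinuousLinearMap.norm_map_iff_adjoint_comp_self _).1 norm_wienerOp_X

/-- The series `X - α`. -/
noncomputable def rootFactor (α : ℂ) : wiener := wienerX - algebraMap ℂ wiener α

/-- The series `1 - ᾱ X`. -/
noncomputable def reflFactor (α : ℂ) : wiener := 1 - conj α • wienerX

theorem wienerOp_mul_apply (p q : wiener) (x : Ell 2) :
    wienerOp (p * q) x = wienerOp p (wienerOp q x) := by rw [map_mul]; rfl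

theorem adjoint_wienerOp_mul (p q : wiener) (x : Ell 2) :
    adjoint (wienerOp (p * q)) x = adjoint (wienerOp p) (adjoint (wienerOp q) x) := by
  rw [mul_comm, map_mul, ContinuousLinearMap.mul_def, ContinuousLinearMap.adjoint_comp]
  rfl

theorem adjoint_one : adjoint (1 : Ell 2 →L[ℂ] Ell 2) = 1 := star_one _

theorem adjoint_wienerOp_X_apply (x : Ell 2) :
    adjoint (wienerOp wienerX) (wienerOp wienerX x) = x :=
  DFunLike.congr_fun adjoint_wienerOp_X_comp x

/-- With `S` the shift, `S* S = 1` gives `(1 - α S*) S = S - α`. -/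
theorem adjoint_reflFactor (α : ℂ) (x : Ell 2) :
    adjoint (wienerOp (reflFactor α)) (wienerOp wienerX x) = wienerOp (rootFactor α) x := by
  have h : adjoint (wienerOp (reflFactor α)) = 1 - α • adjoint (wienerOp wienerX) := by
    rw [reflFactor, map_sub, map_one, map_smul, map_sub, map_smulₛₗ, adjoint_one,
      Complex.conj_conj]
  simp [h, rootFactor, adjoint_wienerOp_X_apply, Algebra.algebraMap_eq_smul_one]

theorem adjoint_rootFactor (α : ℂ) (x : Ell 2) :
    adjoint (wienerOp (rootFactor α)) (wienerOp wienerX x) = wienerOp (reflFactor α) x := by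
  have h : adjoint (wienerOp (rootFactor α)) = adjoint (wienerOp wienerX) - conj α • 1 := by
    rw [rootFactor, Algebra.algebraMap_eq_smul_one, map_sub, map_smul, map_one, map_sub,
      map_smulₛₗ, adjoint_one]
  simp [h, reflFactor, adjoint_wienerOp_X_apply]

/-- The polynomial `∏ (X - α)`. -/
noncomputable def rootProd (s : Multiset ℂ) : wiener := (s.map rootFactor).prod

/-- The polynomial `∏ (1 - ᾱ X)`. -/
noncomputable def reflProd (s : Multiset ℂ) : wiener := (s.map reflFactor).prod

theorem adjoint_reflProd (s : Multiset ℂ) (x : Ell 2) :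
    adjoint (wienerOp (reflProd s)) (wienerOp (wienerX ^ s.card) x) =
      wienerOp (rootProd s) x := by
  induction s using Multiset.induction_on generalizing x with
  | empty => simp [reflProd, rootProd, adjoint_one]
  | cons α s ih =>
    simp only [reflProd, rootProd, Multiset.map_cons, Multiset.prod_cons, Multiset.card_cons]
      at ih ⊢
    rw [mul_comm, adjoint_wienerOp_mul, pow_succ', wienerOp_mul_apply, adjoint_reflFactor,
      ← wienerOp_mul_apply, mul_comm, wienerOp_mul_apply, ih, mul_comm, wienerOp_mul_apply]

theorem adjoint_rootProd (s : Multiset ℂ) (x : Ell 2) :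
    adjoint (wienerOp (rootProd s)) (wienerOp (wienerX ^ s.card) x) =
      wienerOp (reflProd s) x := by
  induction s using Multiset.induction_on generalizing x with
  | empty => simp [reflProd, rootProd, adjoint_one]
  | cons α s ih =>
    simp only [reflProd, rootProd, Multiset.map_cons, Multiset.prod_cons, Multiset.card_cons]
      at ih ⊢
    rw [mul_comm, adjoint_wienerOp_mul, pow_succ', wienerOp_mul_apply, adjoint_rootFactor,
      ← wienerOp_mul_apply, mul_comm, wienerOp_mul_apply, ih, mul_comm, wienerOp_mul_apply]

/-- The operator form of `|w - α| = |1 - ᾱ w|` on the unit circle. With `P = T_{∏ (X - α)}` and `R =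
T_{∏ (1 - ᾱ X)}`, the two reflection identities and commuting adjoints give `P* P = P* R* Sⁿ = R* P*
Sⁿ = R* R`. -/
theorem norm_rootProd_eq (s : Multiset ℂ) (x : Ell 2) :
    ‖wienerOp (rootProd s) x‖ = ‖wienerOp (reflProd s) x‖ := by
  have h : adjoint (wienerOp (rootProd s)) (wienerOp (rootProd s) x) =
      adjoint (wienerOp (reflProd s)) (wienerOp (reflProd s) x) := by
    conv_lhs => rw [← adjoint_reflProd, ← adjoint_wienerOp_mul, mul_comm, adjoint_wienerOp_mul,
      adjoint_rootProd]
  have h2 : ⟪wienerOp (rootProd s) x, wienerOp (rootProd s) x⟫_ℂ =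
      ⟪wienerOp (reflProd s) x, wienerOp (reflProd s) x⟫_ℂ := by
    rw [← ContinuousLinearMap.adjoint_inner_left, h, ContinuousLinearMap.adjoint_inner_left]
  rw [inner_self_eq_norm_sq_to_K, inner_self_eq_norm_sq_to_K] at h2
  norm_cast at h2
  exact (sq_eq_sq₀ (norm_nonneg _) (norm_nonneg _)).1 h2

/-- The reciprocal of `∏ (1 - ᾱ X)`. -/
noncomputable def reflInv (s : Multiset ℂ) (hs : ∀ α ∈ s, ‖α‖ < 1) : wiener :=
  (s.pmap (fun α h => wienerGeom (conj α) (by simpa using h)) hs).prod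

theorem reflInv_mul (s : Multiset ℂ) (hs : ∀ α ∈ s, ‖α‖ < 1) :
    reflInv s hs * reflProd s = 1 := by
  induction s using Multiset.induction_on with
  | empty => simp [reflInv, reflProd]
  | cons α s ih =>
    have := ih fun β hβ => hs β (Multiset.mem_cons_of_mem hβ)
    simp only [reflInv, reflProd, Multiset.map_cons, Multiset.prod_cons, Multiset.pmap_cons]
      at this ⊢
    rw [mul_mul_mul_comm, this, reflFactor, wienerGeom_mul, mul_one]

/-- The Taylor series of the Blaschke product. -/
noncomputable def blaschkeSeries (s : Multiset ℂ) (hs : ∀ α ∈ s, ‖α‖ < 1) : wiener :=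
  rootProd s * reflInv s hs

theorem norm_blaschkeSeries (s : Multiset ℂ) (hs : ∀ α ∈ s, ‖α‖ < 1) (x : Ell 2) :
    ‖wienerOp (blaschkeSeries s hs) x‖ = ‖x‖ := by
  rw [blaschkeSeries, wienerOp_mul_apply, norm_rootProd_eq, ← wienerOp_mul_apply, mul_comm,
    reflInv_mul, map_one]
  rfl

theorem wienerEval_rootProd (s : Multiset ℂ) (w : ℂ) (hw : ‖w‖ ≤ 1) :
    wienerEval w hw (rootProd s) = (s.map fun α => w - α).prod := by
  rw [rootProd, map_multiset_prod, Multiset.map_map]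
  congr 1
  refine Multiset.map_congr rfl fun α _ => ?_
  simp [rootFactor, wienerEval_X]

theorem wienerEval_reflProd (s : Multiset ℂ) (w : ℂ) (hw : ‖w‖ ≤ 1) :
    wienerEval w hw (reflProd s) = (s.map fun α => 1 - conj α * w).prod := by
  rw [reflProd, map_multiset_prod, Multiset.map_map]
  congr 1
  refine Multiset.map_congr rfl fun α _ => ?_
  simp [reflFactor, wienerEval_X]

theorem wienerEval_blaschkeSeries (s : Multiset ℂ) (hs : ∀ α ∈ s, ‖α‖ < 1) (w : ℂ)
    (hw : ‖w‖ ≤ 1) : wienerEval w hw (blaschkeSeries s hs) = blaschke s w := by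
  have h := congrArg (wienerEval w hw) (reflInv_mul s hs)
  rw [map_mul, map_one] at h
  rw [blaschke, Multiset.prod_map_div, blaschkeSeries, map_mul, wienerEval_rootProd,
    ← wienerEval_reflProd s w hw, eq_div_iff (right_ne_zero_of_mul_eq_one h), mul_assoc, h, mul_one]

/-! ### Fourier coefficients of the Blaschke product -/

/-- The Fourier coefficients of an absolutely convergent power series on the unit circle. -/
theorem fourierCoeff_wienerEval (p : wiener) (k : ℕ) :
    (2 * Real.pi : ℂ)⁻¹ * ∫ ω in (0 : ℝ)..2 * Real.pi,
      (∑' j, coeff j (p : PowerSeries ℂ) * Complex.exp (Complex.I * ω) ^ j) *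
        Complex.exp (-(Complex.I * k * ω)) = coeff k (p : PowerSeries ℂ) := by
  have hexp : ∀ (j : ℕ) (ω : ℝ), Complex.exp (Complex.I * ω) ^ j *
      Complex.exp (-(Complex.I * k * ω)) = Complex.exp (Complex.I * ((j : ℂ) - k) * ω) := by
    intro j ω
    rw [← Complex.exp_nat_mul, ← Complex.exp_add]
    congr 1
    ring
  have hnorm : ∀ (j : ℕ) (ω : ℝ), ‖Complex.exp (Complex.I * ((j : ℂ) - k) * ω)‖ = 1 := by
    intro j ω
    rw [show Complex.I * ((j : ℂ) - k) * ω = ((((j : ℝ) - k) * ω : ℝ) : ℂ) * Complex.I by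
      push_cast; ring, Complex.norm_exp_ofReal_mul_I]
  have hint : ∀ j : ℕ, ∫ ω in (0 : ℝ)..2 * Real.pi, Complex.exp (Complex.I * ((j : ℂ) - k) * ω) =
      if j = k then 2 * Real.pi else 0 := by
    intro j
    split_ifs with hjk
    · simp [hjk]
    · have hne : (j : ℂ) - k ≠ 0 := sub_ne_zero.2 (by exact_mod_cast hjk)
      rw [integral_exp_mul_complex (mul_ne_zero Complex.I_ne_zero hne)]
      -- A nonzero integer frequency has equal antiderivative values at `0` and `2π`.
      have : Complex.I * ((j : ℂ) - k) * ((2 * Real.pi : ℝ) : ℂ) =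
          ((j : ℤ) - k : ℤ) * (2 * Real.pi * Complex.I) := by push_cast; ring
      rw [this, Complex.exp_int_mul_two_pi_mul_I]
      simp
  -- The summable coefficient norms dominate the terms, so sum and integral may be exchanged.
  have hsum := intervalIntegral.hasSum_integral_of_dominated_convergence (a := 0)
    (b := 2 * Real.pi) (μ := MeasureTheory.volume)
    (F := fun j (ω : ℝ) =>
      coeff j (p : PowerSeries ℂ) * Complex.exp (Complex.I * ((j : ℂ) - k) * ω))
    (f := fun ω : ℝ => (∑' j, coeff j (p : PowerSeries ℂ) * Complex.exp (Complex.I * ω) ^ j) *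
        Complex.exp (-(Complex.I * k * ω)))
    (fun j _ => ‖coeff j (p : PowerSeries ℂ)‖)
    (fun j => (by fun_prop : Continuous fun ω : ℝ => coeff j (p : PowerSeries ℂ) *
      Complex.exp (Complex.I * ((j : ℂ) - k) * ω)).aestronglyMeasurable)
    (fun j => MeasureTheory.ae_of_all _ fun ω _ => by rw [norm_mul, hnorm, mul_one])
    (MeasureTheory.ae_of_all _ fun _ _ => mem_wiener.1 p.2)
    intervalIntegrable_const
    (MeasureTheory.ae_of_all _ fun ω _ => by
      have hw : ‖Complex.exp (Complex.I * ω)‖ ≤ 1 := by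
        rw [mul_comm, Complex.norm_exp_ofReal_mul_I]
      have := (summable_wiener_eval p hw).of_norm.hasSum.mul_right
        (Complex.exp (-(Complex.I * k * ω)))
      simp only [mul_assoc _ (_ ^ _), hexp] at this
      exact this)
  rw [← hsum.tsum_eq, tsum_eq_single k]
  · rw [intervalIntegral.integral_const_mul, hint, if_pos rfl]
    have : (Real.pi : ℂ) ≠ 0 := by exact_mod_cast Real.pi_ne_zero
    push_cast
    field_simp
  · intro j hj
    rw [intervalIntegral.integral_const_mul, hint, if_neg hj]
    simp

theorem blaschkeCoeff_eq (s : Multiset ℂ) (hs : ∀ α ∈ s, ‖α‖ < 1) (k : ℕ) :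
    wienerCoeff (blaschkeSeries s hs) k = blaschkeCoeff s k := by
  rw [wienerCoeff_apply, ← fourierCoeff_wienerEval, blaschkeCoeff]
  congr 2
  ext ω
  rw [← wienerEval_blaschkeSeries s hs _ (by rw [mul_comm, Complex.norm_exp_ofReal_mul_I]),
    wienerEval_apply]

end ExpSumHankel

/-! ### Bounds for singular values -/

namespace ExpSumHankel

open ContinuousLinearMap (adjoint)
open scoped InnerProduct InnerProductSpace

theorem singularValue_le (A R : Ell 2 →L[ℂ] Ell 2) {n : ℕ}
    (hR : LinearMap.rank (R : Ell 2 →ₗ[ℂ] Ell 2) ≤ n) : singularValue A n ≤ ‖A - R‖ :=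
  csInf_le ⟨0, by rintro r ⟨R, -, rfl⟩; exact norm_nonneg _⟩ ⟨R, hR, rfl⟩

theorem le_singularValue {A : Ell 2 →L[ℂ] Ell 2} {n : ℕ} {δ : ℝ}
    (h : ∀ R : Ell 2 →L[ℂ] Ell 2, LinearMap.rank (R : Ell 2 →ₗ[ℂ] Ell 2) ≤ n → δ ≤ ‖A - R‖) :
    δ ≤ singularValue A n :=
  le_csInf ⟨_, 0, by simp, rfl⟩ (by rintro r ⟨R, hR, rfl⟩; exact h R hR)

theorem singularValue_nonneg (A : Ell 2 →L[ℂ] Ell 2) (n : ℕ) : 0 ≤ singularValue A n :=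
  le_singularValue fun _ _ => norm_nonneg _

theorem singularValue_anti (A : Ell 2 →L[ℂ] Ell 2) : Antitone (singularValue A) :=
  fun _ _ hnm => le_singularValue fun R hR =>
    singularValue_le A R (hR.trans (by exact_mod_cast hnm))

theorem singularValue_comp_le (A T : Ell 2 →L[ℂ] Ell 2) (hT : ‖T‖ ≤ 1) (n : ℕ) :
    singularValue (A ∘L T) n ≤ singularValue A n :=
  le_singularValue fun R hR => by
    have hRT : LinearMap.rank ((R ∘L T : Ell 2 →L[ℂ] Ell 2) : Ell 2 →ₗ[ℂ] Ell 2) ≤ n :=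
      (LinearMap.rank_comp_le_left (T : Ell 2 →ₗ[ℂ] Ell 2) (R : Ell 2 →ₗ[ℂ] Ell 2)).trans hR
    refine (singularValue_le _ _ hRT).trans ?_
    rw [← ContinuousLinearMap.sub_comp]
    exact (ContinuousLinearMap.opNorm_comp_le _ _).trans
      (mul_le_of_le_one_right (norm_nonneg _) hT)

/-- An operator bounded below by `δ` on a subspace of dimension more than `n` has `n`-th singular
value at least `δ`. -/
theorem le_singularValue_of_subspace {A : Ell 2 →L[ℂ] Ell 2} {n : ℕ} {δ : ℝ}
    (V : Submodule ℂ (Ell 2)) (hV : (n : Cardinal) < Module.rank ℂ V)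
    (h : ∀ x ∈ V, δ * ‖x‖ ≤ ‖A x‖) : δ ≤ singularValue A n :=
  le_singularValue fun R hR => by
    -- An operator of rank at most `n` cannot be injective on `V`; on a kernel vector `A - R` agrees
    -- with `A`.
    obtain ⟨x, hx, hx0⟩ : ∃ x ∈ V, x ≠ 0 ∧ R x = 0 := by
      by_contra! hc
      have hinj : Function.Injective ((R : Ell 2 →ₗ[ℂ] Ell 2) ∘ₗ V.subtype) := by
        rw [← LinearMap.ker_eq_bot, LinearMap.ker_eq_bot']
        intro x hx
        by_contra hx0
        exact hc x x.2 (by simpa using hx0) hx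
      have h1 := LinearMap.rank_comp_le_left V.subtype (R : Ell 2 →ₗ[ℂ] Ell 2)
      rw [LinearMap.rank, rank_range_of_injective _ hinj] at h1
      exact absurd (h1.trans hR) (not_le.2 hV)
    have h1 := h x hx
    have h2 := (A - R).le_opNorm x
    rw [sub_apply, hx0.2, sub_zero] at h2
    exact le_of_mul_le_mul_right (h1.trans h2) (norm_pos_iff.2 hx0.1)

theorem singularValue_pos_of_subspace {A : Ell 2 →L[ℂ] Ell 2} {n : ℕ}
    (V : Submodule ℂ (Ell 2)) [FiniteDimensional ℂ V] (hV : (n : Cardinal) < Module.rank ℂ V)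
    (h : ∀ x ∈ V, A x = 0 → x = 0) : 0 < singularValue A n := by
  obtain ⟨C, hC, hA⟩ := LinearMap.exists_antilipschitzWith
    ((A : Ell 2 →ₗ[ℂ] Ell 2) ∘ₗ V.subtype) (LinearMap.ker_eq_bot'.2 fun x hx =>
      Subtype.ext (h x x.2 hx))
  have hC' : (0 : ℝ) < C := hC
  refine (inv_pos.2 hC').trans_le (le_singularValue_of_subspace V hV fun x hx => ?_)
  have h1 := hA.le_mul_dist ⟨x, hx⟩ 0
  rw [dist_zero_right, map_zero, dist_zero_right] at h1
  rw [inv_mul_le_iff₀ hC']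
  exact h1

/-- On the eigenspace of `A* A` for `σ²`, `‖A x‖² = σ² ‖x‖²`. -/
theorem le_singularValue_of_multiplicity {A : Ell 2 →L[ℂ] Ell 2} {n : ℕ} {σ : ℝ}
    (h : ((n + 1 : ℕ) : Cardinal) ≤ singularMultiplicity A σ) : σ ≤ singularValue A n := by
  refine le_singularValue_of_subspace _ (lt_of_lt_of_le (by exact_mod_cast n.lt_succ_self) h)
    fun x hx => ?_
  rw [Module.End.mem_eigenspace_iff] at hx
  have hx' : adjoint A (A x) = ((σ ^ 2 : ℝ) : ℂ) • x := hx
  have h1 : ⟪A x, A x⟫_ℂ = ((σ ^ 2 : ℝ) : ℂ) * ⟪x, x⟫_ℂ := by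
    rw [← ContinuousLinearMap.adjoint_inner_right, hx', inner_smul_right]
  rw [inner_self_eq_norm_sq_to_K, inner_self_eq_norm_sq_to_K] at h1
  have h2 : (σ * ‖x‖) ^ 2 = ‖A x‖ ^ 2 := by
    rw [mul_pow]
    exact Complex.ofReal_injective (by simpa using h1.symm)
  exact (abs_le_of_sq_le_sq' h2.le (norm_nonneg _)).2

/-! ### Rank, positivity and rational range of the Hankel operator -/

section Hankel

variable {N : ℕ} {a z : Fin N → ℂ} (hz1 : ∀ j, ‖z j‖ < 1)

/-- A sequence supported on `{0, …, N - 1}`. -/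
noncomputable def finSeq (N : ℕ) : (Fin N → ℂ) →ₗ[ℂ] Ell 2 where
  toFun c := ∑ i, c i • lp.single 2 (i : ℕ) 1
  map_add' c d := by simp [add_smul, Finset.sum_add_distrib]
  map_smul' r c := by simp [Finset.smul_sum, mul_smul]

theorem genFun_finSeq (c : Fin N → ℂ) {w : ℂ} (hw : ‖w‖ < 1) :
    genFun (finSeq N c) w = ∑ i, c i * w ^ (i : ℕ) := by
  have h := inner_geomVec (conj w) (by simpa using hw) (finSeq N c)
  rw [Complex.conj_conj] at h
  rw [← h]
  simp [finSeq, lp.inner_single_right, geomVec_apply]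

/-- Two Vandermonde arguments: the geometric sequences are independent, so the polynomial of `c`
vanishes at every `z j`; having degree below `N` and `N` distinct zeros, it is zero. -/
theorem hankelOp_finSeq_injective (ha : ∀ j, a j ≠ 0) (hinj : Function.Injective z)
    {c : Fin N → ℂ} (hc : hankelOp (expSum a z hz1) (finSeq N c) = 0) : c = 0 := by
  have h1 : (fun j => a j * genFun (finSeq N c) (z j)) = 0 := by
    refine Matrix.eq_zero_of_forall_pow_sum_mul_pow_eq_zero hinj fun i => ?_
    have := congrArg (fun x : Ell 2 => x i) hc
    rw [hankelOp_expSum] at this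
    simpa only [lp.coeFn_sum, Finset.sum_apply, lp.coeFn_smul, Pi.smul_apply, geomVec_apply,
      smul_eq_mul, lp.coeFn_zero, Pi.zero_apply] using this
  refine Matrix.eq_zero_of_forall_index_sum_mul_pow_eq_zero hinj fun j => ?_
  rw [← genFun_finSeq _ (hz1 j)]
  simpa [ha j] using congrFun h1 j

theorem singularValue_hankelOp_pos (ha : ∀ j, a j ≠ 0) (hinj : Function.Injective z)
    {K : ℕ} (hK : K < N) : 0 < singularValue (hankelOp (expSum a z hz1)) K := by
  have hi : Function.Injective (finSeq N) := by
    rw [← LinearMap.ker_eq_bot, LinearMap.ker_eq_bot']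
    exact fun c hc => hankelOp_finSeq_injective hz1 ha hinj (by rw [hc, map_zero])
  refine singularValue_pos_of_subspace (LinearMap.range (finSeq N)) ?_ ?_
  · rw [rank_range_of_injective _ hi]
    simpa using hK
  · rintro _ ⟨c, rfl⟩ hc
    rw [hankelOp_finSeq_injective hz1 ha hinj hc, map_zero]

theorem rank_hankelOp_le :
    LinearMap.rank (hankelOp (expSum a z hz1) : Ell 2 →ₗ[ℂ] Ell 2) ≤ N := by
  have h : LinearMap.range (hankelOp (expSum a z hz1) : Ell 2 →ₗ[ℂ] Ell 2) ≤
      Submodule.span ℂ (Set.range fun j => geomVec (z j) (hz1 j)) := by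
    rintro _ ⟨x, rfl⟩
    rw [ContinuousLinearMap.coe_coe, hankelOp_expSum]
    exact Submodule.sum_mem _ fun j _ => Submodule.smul_mem _ _ (Submodule.subset_span ⟨j, rfl⟩)
  refine (Submodule.rank_mono h).trans ((rank_span_le _).trans ?_)
  simpa using Cardinal.mk_range_le_lift (f := fun j => geomVec (z j) (hz1 j))

theorem singularValue_hankelOp_eq_zero {n : ℕ} (hn : N ≤ n) :
    singularValue (hankelOp (expSum a z hz1)) n = 0 := by
  refine le_antisymm ?_ (singularValue_nonneg _ _)
  simpa using singularValue_le (hankelOp (expSum a z hz1)) (hankelOp (expSum a z hz1))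
    ((rank_hankelOp_le hz1).trans (by exact_mod_cast hn))

/-- An element of the range of the Hankel operator is rational. -/
theorem exists_poly_of_hankelOp (x : Ell 2) : ∃ q : Polynomial ℂ,
    wienerOp (∏ j, (1 - z j • wienerX)) (hankelOp (expSum a z hz1) x) =
      wienerOp (wienerPoly q) unitVec := by
  have hfac : ∀ j, wienerPoly (1 - z j • Polynomial.X) = 1 - z j • wienerX := fun j => by
    rw [map_sub, map_one, map_smul, wienerPoly_X]
  -- Each geometric vector cancels its own factor `1 - z j X`, leaving the product of the others.
  refine ⟨∑ j, (a j * genFun x (z j)) • ∏ i ∈ Finset.univ.erase j, (1 - z i • Polynomial.X), ?_⟩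
  rw [hankelOp_expSum, map_sum, map_sum, map_sum, sum_apply]
  refine Finset.sum_congr rfl fun j _ => ?_
  rw [← Finset.mul_prod_erase _ _ (Finset.mem_univ j), mul_comm, map_smul, wienerOp_mul_apply,
    wienerOp_geomVec, map_smul, map_smul, smul_apply]
  congr 4
  rw [map_prod]
  simp only [hfac]

end Hankel

end ExpSumHankel

namespace ExpSumHankel

open ContinuousLinearMap (adjoint)
open scoped InnerProduct InnerProductSpace

/-! ### Eigenvectors from the Blaschke factorisation -/

section Eigen

variable {N : ℕ} {a z : Fin N → ℂ} (hz1 : ∀ j, ‖z j‖ < 1)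

/-- If `Γ v̄ = σ v` and `v = ∏ (X - α) w`, then `Γ T_{b̄}` maps the conjugate of `Xⁱ w` to
`σ X^{n - i} w`. -/
theorem hankelOp_blaschke_apply {σ : ℝ} {v w : Ell 2}
    (hv : hankelOp (expSum a z hz1) (star v) = (σ : ℂ) • v) (s : Multiset ℂ)
    (hs : ∀ α ∈ s, ‖α‖ < 1) (hw : wienerOp (rootProd s) w = v) {i j : ℕ} (hij : i + j = s.card) :
    hankelOp (expSum a z hz1) (toeplitzOp (star (wienerCoeff (blaschkeSeries s hs)))
      (star (wienerOp (wienerX ^ i) w))) = (σ : ℂ) • wienerOp (wienerX ^ j) w := by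
  have h1 : wienerOp (blaschkeSeries s hs) (wienerOp (wienerX ^ i) w) =
      wienerOp (wienerX ^ i * reflInv s hs) v := by
    rw [← hw, ← wienerOp_mul_apply, ← wienerOp_mul_apply, blaschkeSeries]
    congr 2
    ring
  have h2 : wienerX ^ i * reflInv s hs * reflProd s = wienerX ^ i := by
    rw [mul_assoc, reflInv_mul, mul_one]
  have h3 : ∀ (k : ℕ) (x : Ell 2),
      adjoint (wienerOp (wienerX ^ k)) (wienerOp (wienerX ^ k) x) = x := by
    intro k
    induction k with
    | zero => simp [adjoint_one]
    | succ k ih =>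
      intro x
      rw [pow_succ, adjoint_wienerOp_mul, mul_comm, wienerOp_mul_apply, adjoint_wienerOp_X_apply,
        ih]
  -- Commuting moves `Xⁱ · reflInv` out of `Γ` as an adjoint, and `v` becomes the adjoint of
  -- `reflProd` on `X^(i+j) w`. The symbols multiply to `Xⁱ`, whose adjoint strips `i` shifts.
  rw [toeplitzOp_star, ← wienerOp_eq, h1, hankelOp_star_wienerOp, hv, map_smul, ← hw,
    ← adjoint_reflProd, ← adjoint_wienerOp_mul, h2, ← hij, pow_add, wienerOp_mul_apply, h3]

theorem adjoint_hankelOp_blaschke (p : wiener) (x : Ell 2) :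
    adjoint (hankelOp (expSum a z hz1) ∘L toeplitzOp (star (wienerCoeff p))) (star x) =
      star ((hankelOp (expSum a z hz1) ∘L toeplitzOp (star (wienerCoeff p))) x) := by
  rw [ContinuousLinearMap.adjoint_comp, ContinuousLinearMap.comp_apply, adjoint_hankelOp,
    adjoint_star _ _ (toeplitzOp_star _), ContinuousLinearMap.comp_apply, hankelOp_toeplitzOp_star,
    wienerOp_eq]

theorem le_singularMultiplicity {σ : ℝ} {v w : Ell 2} (hv0 : v ≠ 0)
    (hv : hankelOp (expSum a z hz1) (star v) = (σ : ℂ) • v) (s : Multiset ℂ)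
    (hs : ∀ α ∈ s, ‖α‖ < 1) (hw : wienerOp (rootProd s) w = v) :
    ((s.card + 1 : ℕ) : Cardinal) ≤ singularMultiplicity
      (hankelOp (expSum a z hz1) ∘L toeplitzOp (star (wienerCoeff (blaschkeSeries s hs)))) σ := by
  set A := hankelOp (expSum a z hz1) ∘L toeplitzOp (star (wienerCoeff (blaschkeSeries s hs)))
    with hA
  have hw0 : w ≠ 0 := by
    rintro rfl
    exact hv0 (by rw [← hw, map_zero])
  have hAi : ∀ i j, i + j = s.card →
      A (star (wienerOp (wienerX ^ i) w)) = (σ : ℂ) • wienerOp (wienerX ^ j) w :=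
    fun i j hij => hankelOp_blaschke_apply hz1 hv s hs hw hij
  have hmem : ∀ i : Fin (s.card + 1), star (wienerOp (wienerX ^ (i : ℕ)) w) ∈
      Module.End.eigenspace ((adjoint A ∘L A : Ell 2 →L[ℂ] Ell 2) : Module.End ℂ (Ell 2))
        ((σ ^ 2 : ℝ) : ℂ) := by
    intro i
    rw [Module.End.mem_eigenspace_iff]
    change adjoint A (A _) = _
    -- `A` sends exponent `i` to `n - i`; conjugate symmetry turns `A*` into the same reflection,
    -- which returns to `i`.
    rw [hAi i (s.card - i) (by omega), map_smul, ← star_star (wienerOp (wienerX ^ (_ - _)) w), hA,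
      adjoint_hankelOp_blaschke, ← hA, hAi (s.card - i) i (by omega), star_smul, smul_smul]
    congr 1
    simp [sq]
  have hli : LinearIndependent ℂ fun i : Fin (s.card + 1) =>
      (⟨_, hmem i⟩ : Module.End.eigenspace
        ((adjoint A ∘L A : Ell 2 →L[ℂ] Ell 2) : Module.End ℂ (Ell 2)) ((σ ^ 2 : ℝ) : ℂ)) := by
    rw [Fintype.linearIndependent_iff]
    intro c hc i
    have h1 := congrArg (fun x => star (Subtype.val x)) hc
    simp only [Submodule.coe_sum, Submodule.coe_smul, star_sum, star_smul, star_star,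
      ZeroMemClass.coe_zero, star_zero] at h1
    -- Once conjugated, a linear relation says that a polynomial multiple of `w` vanishes.
    have h2 : wienerOp (wienerPoly (∑ i : Fin (s.card + 1),
        Polynomial.monomial (i : ℕ) (star (c i)))) w = 0 := by
      rw [← h1, map_sum, map_sum, sum_apply]
      refine Finset.sum_congr rfl fun i _ => ?_
      rw [← Polynomial.smul_X_eq_monomial, map_smul, map_smul, map_pow, wienerPoly_X]
      rfl
    have h3 := wienerPoly_injective ((wienerOp_apply_eq_zero h2 hw0).trans (map_zero _).symm)
    have h4 := congrArg (fun p => Polynomial.coeff p i) h3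
    simpa [Polynomial.finsetSum_coeff, Polynomial.coeff_monomial, Fin.val_inj] using h4
  simpa [singularMultiplicity] using hli.cardinal_le_rank

theorem norm_toeplitzOp_star_blaschkeSeries_le (s : Multiset ℂ) (hs : ∀ α ∈ s, ‖α‖ < 1) :
    ‖toeplitzOp (star (wienerCoeff (blaschkeSeries s hs)))‖ ≤ 1 := by
  refine ContinuousLinearMap.opNorm_le_bound _ zero_le_one fun x => ?_
  rw [← star_star x, toeplitzOp_star, norm_star, ← wienerOp_eq, norm_blaschkeSeries, star_star,
    norm_star, one_mul]

theorem card_le_of_simple (ha : ∀ j, a j ≠ 0) (hinj : Function.Injective z)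
    {K : ℕ} (hK : K < N)
    (hsimple : ∀ k < N, k ≠ K →
      singularValue (hankelOp (expSum a z hz1)) K ≠ singularValue (hankelOp (expSum a z hz1)) k)
    {T : Ell 2 →L[ℂ] Ell 2} (hT : ‖T‖ ≤ 1) {n : ℕ}
    (hn : ((n + 1 : ℕ) : Cardinal) ≤ singularMultiplicity (hankelOp (expSum a z hz1) ∘L T)
      (singularValue (hankelOp (expSum a z hz1)) K)) : n ≤ K := by
  by_contra! hlt
  have h1 := (le_singularValue_of_multiplicity hn).trans (singularValue_comp_le _ _ hT n)
  have h2 := h1.antisymm (singularValue_anti _ hlt.le)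
  -- Simplicity only concerns indices below `N`; from `N` on the singular values vanish, whereas
  -- `σ_K > 0`.
  rcases lt_or_ge n N with h | h
  · exact hsimple n h hlt.ne' h2
  · rw [singularValue_hankelOp_eq_zero hz1 h] at h2
    exact (singularValue_hankelOp_pos hz1 ha hinj hK).ne' h2

end Eigen

/-! ### Zeros of rational generating functions -/

section Zeros

theorem wienerPoly_rootProd (s : Multiset ℂ) :
    wienerPoly (s.map fun α => Polynomial.X - Polynomial.C α).prod = rootProd s := by
  rw [rootProd, map_multiset_prod, Multiset.map_map]
  congr 1
  refine Multiset.map_congr rfl fun α _ => ?_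
  rw [Function.comp_apply, map_sub, wienerPoly_X, rootFactor, ← Polynomial.algebraMap_eq,
    AlgHom.commutes]

/-- The roots of a polynomial in the open unit disc. -/
noncomputable def discRoots (q : Polynomial ℂ) : Multiset ℂ := by
  classical exact q.roots.filter fun α => ‖α‖ < 1

theorem norm_lt_one_of_mem_discRoots {q : Polynomial ℂ} {α : ℂ} (h : α ∈ discRoots q) :
    ‖α‖ < 1 := by
  classical exact (Multiset.mem_filter.1 h).2

theorem count_discRoots (q : Polynomial ℂ) {α : ℂ} (h : ‖α‖ < 1) :
    (discRoots q).count α = q.rootMultiplicity α := by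
  classical
  rw [discRoots, Multiset.count_filter_of_pos (p := fun α : ℂ => ‖α‖ < 1) h, Polynomial.count_roots]

theorem discRoots_dvd (q : Polynomial ℂ) :
    ((discRoots q).map fun α => Polynomial.X - Polynomial.C α).prod ∣ q := by
  classical
  exact (Multiset.prod_dvd_prod_of_le (Multiset.map_le_map (Multiset.filter_le _ _))).trans
    (Polynomial.prod_multiset_X_sub_C_dvd q)

/-- The zeros in the disc of the generating function of a rational sequence. -/
theorem isZerosInDisc_discRoots {v : Ell 2} {D q : Polynomial ℂ} (hq : q ≠ 0)
    (hD : ∀ w : ℂ, ‖w‖ < 1 → D.eval w ≠ 0)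
    (hv : wienerOp (wienerPoly D) v = wienerOp (wienerPoly q) unitVec) :
    IsZerosInDisc v (discRoots q) := by
  refine ⟨fun α hα => ?_, fun α => norm_lt_one_of_mem_discRoots⟩
  have hgen : ∀ w : ℂ, ‖w‖ < 1 → genFun v w = q.eval w / D.eval w := fun w hw => by
    rw [eq_div_iff (hD w hw), mul_comm, ← wienerEval_poly w hw.le, ← genFun_wienerOp _ _ hw, hv,
      genFun_wienerOp _ _ hw, wienerEval_poly, genFun_unitVec, mul_one]
  have hev : ∀ᶠ w : ℂ in nhds α, ‖w‖ < 1 := continuous_norm.continuousAt.eventually_lt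
    continuousAt_const hα
  have han : ∀ p : Polynomial ℂ, AnalyticAt ℂ (fun w => p.eval w) α := fun p => by
    simpa [Polynomial.coe_aeval_eq_eval] using (analyticAt_id (𝕜 := ℂ) (z := α)).aeval_polynomial p
  have hanv : AnalyticAt ℂ (genFun v) α := by
    refine ((han q).div (han D) (hD α hα)).congr ?_
    filter_upwards [hev] with w hw using (hgen w hw).symm
  rw [count_discRoots q hα, hanv.analyticOrderAt_eq_natCast]
  -- With `q = (X - α)^m g` and `g(α) ≠ 0`, the quotient `g / D` is the nonvanishing analytic
  -- factor.
  obtain ⟨g, hg, hdvd⟩ := Polynomial.exists_eq_pow_rootMultiplicity_mul_and_not_dvd q hq α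
  refine ⟨fun w => g.eval w / D.eval w, (han g).div (han D) (hD α hα),
    div_ne_zero (fun h => hdvd (Polynomial.dvd_iff_isRoot.2 h)) (hD α hα), ?_⟩
  filter_upwards [hev] with w hw
  rw [hgen w hw]
  nth_rw 1 [hg]
  simp [mul_div_assoc]

end Zeros

end ExpSumHankel

/-! ### The main theorem -/

theorem mainTheorem4 {N : ℕ} (a z : Fin N → ℂ) (ha : ∀ j, a j ≠ 0)
    (hz0 : ∀ j, z j ≠ 0) (hz1 : ∀ j, ‖z j‖ < 1) (hinj : Function.Injective z)
    (K : ℕ) (hK : K < N)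
    (hsimple : ∀ k < N, k ≠ K →
      singularValue (hankelOp (expSum a z hz1)) K ≠ singularValue (hankelOp (expSum a z hz1)) k)
    (v : Ell 2) (hv0 : v ≠ 0)
    (hv : hankelOp (expSum a z hz1) (star v) =
      ((singularValue (hankelOp (expSum a z hz1)) K : ℝ) : ℂ) • v) :
    ∃ (s : Multiset ℂ) (b : Ell 1),
      IsZerosInDisc v s ∧
      (∀ k, b k = blaschkeCoeff s k) ∧
      ((s.card + 1 : ℕ) : Cardinal) ≤
        singularMultiplicity (hankelOp (expSum a z hz1) ∘L toeplitzOp (star b))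
          (singularValue (hankelOp (expSum a z hz1)) K) ∧
      s.card ≤ K := by
  set σ := singularValue (hankelOp (expSum a z hz1)) K
  have hσ0 : (σ : ℂ) ≠ 0 := by
    exact_mod_cast (singularValue_hankelOp_pos hz1 ha hinj hK).ne'
  obtain ⟨q₀, hq₀⟩ := exists_poly_of_hankelOp (a := a) hz1 (star v)
  set D : Polynomial ℂ := ∏ j, (1 - z j • Polynomial.X) with hD
  have hDw : wienerPoly D = ∏ j, (1 - z j • wienerX) := by
    rw [hD, map_prod]
    exact Finset.prod_congr rfl fun j _ => by rw [map_sub, map_one, map_smul, wienerPoly_X]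
  have hDeval : ∀ w : ℂ, ‖w‖ < 1 → D.eval w ≠ 0 := by
    intro w hw
    rw [hD, Polynomial.eval_prod, Finset.prod_ne_zero_iff]
    intro j _ h
    simp only [Polynomial.eval_sub, Polynomial.eval_one, Polynomial.eval_smul, Polynomial.eval_X,
      smul_eq_mul] at h
    have h1 : ‖z j * w‖ < 1 := by
      rw [norm_mul]; exact mul_lt_one_of_nonneg_of_lt_one_left (norm_nonneg _) (hz1 j) hw.le
    rw [← sub_eq_zero.1 h, norm_one] at h1
    exact lt_irrefl _ h1
  set q : Polynomial ℂ := (σ : ℂ)⁻¹ • q₀ with hq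
  have hvq : wienerOp (wienerPoly D) v = wienerOp (wienerPoly q) unitVec := by
    rw [hv, map_smul, ← hDw] at hq₀
    rw [hq, map_smul, map_smul, smul_apply, ← hq₀, inv_smul_smul₀ hσ0]
  have hD0 : D ≠ 0 := fun h => hDeval 0 (by simp) (by rw [h, Polynomial.eval_zero])
  have hq0 : q ≠ 0 := by
    intro h
    rw [h, map_zero, map_zero, zero_apply] at hvq
    exact hD0 (wienerPoly_injective ((wienerOp_apply_eq_zero hvq hv0).trans (map_zero _).symm))
  obtain ⟨q₁, hq₁⟩ := discRoots_dvd q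
  have hs : ∀ α ∈ discRoots q, ‖α‖ < 1 := fun α => norm_lt_one_of_mem_discRoots
  have hG : (∏ j, wienerGeom (z j) (hz1 j)) * wienerPoly D = 1 := by
    rw [hDw, ← Finset.prod_mul_distrib]
    exact Finset.prod_eq_one fun j _ => wienerGeom_mul _ _
  -- Here `w = q₁ / D`: the geometric series invert `D` among absolutely summable series, which
  -- keeps `w` in `ℓ²`.
  have hw : wienerOp (rootProd (discRoots q))
      (wienerOp ((∏ j, wienerGeom (z j) (hz1 j)) * wienerPoly q₁) unitVec) = v := by
    rw [← wienerOp_mul_apply, mul_left_comm, ← wienerPoly_rootProd, ← map_mul, ← hq₁,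
      wienerOp_mul_apply, ← hvq, ← wienerOp_mul_apply, hG, map_one]
    rfl
  have hmult := le_singularMultiplicity hz1 hv0 hv (discRoots q) hs hw
  exact ⟨discRoots q, wienerCoeff (blaschkeSeries _ hs), isZerosInDisc_discRoots hq0 hDeval hvq,
    blaschkeCoeff_eq _ hs, hmult, card_le_of_simple hz1 ha hinj hK hsimple
      (norm_toeplitzOp_star_blaschkeSeries_le _ hs) hmult⟩
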